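/- A modal algebra is a structure $(B;\cup,\cap,\mathrm{C},0,1,f)$ in which $(B;\cup,\cap,\mathrm{C},0,1)$ is a Boolean algebra and $f\colon B\to B$ is a unary function with $f(a\cup b)=f(a)\cup f(b)$ for all $a,b\in B$ and $f(0)=0$. An infinite structure over a finite signature is computable if its domain is a computable subset of $\mathbb N$ and all its functions and relations are computable; it is punctual if its domain is $\mathbb N$ and all its functions and relations are primitive recursive. A class of structures is punctually robust if every (infinite) computable member of the class is isomorphic to a punctual structure. Theorem. The class of modal algebras is not punctually robust; that is, there is an infinite computable modal algebra that is not isomorphic to any modal algebra with domain $\mathbb N$ all of whose operations $\cup,\cap,\mathrm{C},0,1,f$ are primitive recursive. -/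

import Mathlib

/-- A structure over a finite signature whose domain is a set `D` of natural numbers is
*computable* if `D` is infinite and computable and every function and relation of the structure is
computable, i.e. is the restriction to `D` of a computable function or predicate on tuples of
natural numbers. -/
structure IsComputableStructure (L : FirstOrder.Language.{0, 0}) [Finite L.Symbols] (D : Set ℕ)
    [L.Structure D] : Prop where
  infinite_domain : D.Infinite
  computable_domain : ComputablePred (fun n : ℕ => n ∈ D)
  computable_funMap : ∀ (n : ℕ) (f : L.Functions n), ∃ F : (Fin n → ℕ) → ℕ, Computable F ∧
    ∀ x : Fin n → D, F (fun i => (x i : ℕ)) = (FirstOrder.Language.Structure.funMap f x : D)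
  computable_relMap : ∀ (n : ℕ) (R : L.Relations n), ∃ P : (Fin n → ℕ) → Prop, ComputablePred P ∧
    ∀ x : Fin n → D, P (fun i => (x i : ℕ)) ↔ FirstOrder.Language.Structure.RelMap R x

/-- A structure over a finite signature with domain `ℕ` is *punctual* if all of its functions and
relations are primitive recursive. -/
structure IsPunctualStructure (L : FirstOrder.Language.{0, 0}) [Finite L.Symbols] [L.Structure ℕ] :
    Prop where
  primrec_funMap : ∀ (n : ℕ) (f : L.Functions n),
    Primrec (fun x : Fin n → ℕ => FirstOrder.Language.Structure.funMap f x)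
  primrec_relMap : ∀ (n : ℕ) (R : L.Relations n),
    PrimrecPred (fun x : Fin n → ℕ => FirstOrder.Language.Structure.RelMap R x)

/-- A structure is *punctually presentable* if it is isomorphic to a punctual one. -/
def PunctuallyPresentable (L : FirstOrder.Language.{0, 0}) [Finite L.Symbols] (M : Type)
    [L.Structure M] : Prop :=
  ∃ _ : L.Structure ℕ, IsPunctualStructure L ∧ Nonempty (L.Equiv M ℕ)

/-- A class `K` of structures is *punctually robust* if every computable member of `K` is
punctually presentable. -/
def PunctuallyRobust (L : FirstOrder.Language.{0, 0}) [Finite L.Symbols]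
    (K : ∀ M : Type, L.Structure M → Prop) : Prop :=
  ∀ (D : Set ℕ) (S : L.Structure D), IsComputableStructure L D → K D S →
    PunctuallyPresentable L D

/-- The function symbols `∪`, `∩`, `C`, `0`, `1`, `f` of modal algebras, with their arities. -/
inductive ModalFunctions : ℕ → Type
  | union : ModalFunctions 2
  | inter : ModalFunctions 2
  | compl : ModalFunctions 1
  | zero : ModalFunctions 0
  | one : ModalFunctions 0
  | modality : ModalFunctions 1

/-- The signature of modal algebras; it has no relation symbols. -/
def modalLanguage : FirstOrder.Language.{0, 0} where
  Functions := ModalFunctions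
  Relations := fun _ => Empty

instance modalLanguage_finite_symbols : Finite modalLanguage.Symbols := by
  have h1 : Finite (Σ n, modalLanguage.Functions n) := by
    refine Set.finite_univ_iff.mp (Set.Finite.subset (Set.toFinite
      ({⟨2, ModalFunctions.union⟩, ⟨2, ModalFunctions.inter⟩, ⟨1, ModalFunctions.compl⟩,
        ⟨0, ModalFunctions.zero⟩, ⟨0, ModalFunctions.one⟩, ⟨1, ModalFunctions.modality⟩} :
        Set (Σ n, modalLanguage.Functions n))) ?_)
    rintro ⟨n, f⟩ -
    cases f <;> simp
  have h2 : IsEmpty (Σ n, modalLanguage.Relations n) := ⟨fun x => nomatch x.2⟩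
  exact inferInstanceAs (Finite (_ ⊕ _))

/-- `f` is a *modality* on a Boolean algebra: it preserves binary joins and the least element. -/
structure IsModality {B : Type*} [BooleanAlgebra B] (f : B → B) : Prop where
  map_sup : ∀ a b : B, f (a ⊔ b) = f a ⊔ f b
  map_bot : f ⊥ = ⊥

/-- A structure in the signature of modal algebras is a *modal algebra* if its symbols
`∪`, `∩`, `C`, `0`, `1` are interpreted by the operations of a Boolean algebra and its symbol `f`
is interpreted by a modality on this Boolean algebra. -/
def IsModalAlgebra (M : Type) (S : modalLanguage.Structure M) : Prop :=
  ∃ _ : BooleanAlgebra M,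
    (∀ a b : M, S.funMap ModalFunctions.union ![a, b] = a ⊔ b) ∧
    (∀ a b : M, S.funMap ModalFunctions.inter ![a, b] = a ⊓ b) ∧
    (∀ a : M, S.funMap ModalFunctions.compl ![a] = aᶜ) ∧
    S.funMap ModalFunctions.zero ![] = (⊥ : M) ∧
    S.funMap ModalFunctions.one ![] = (⊤ : M) ∧
    IsModality (fun a : M => S.funMap ModalFunctions.modality ![a])

/-! Diagonalisation gives a computable, not primitive recursive χ : ℕ → Bool. It is built into the
algebra of finite and cofinite subsets of ℕ by the modality f with f({k}) = {k+1}, together with k+2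
exactly when χ(k) holds. Then fᵏ(1) = [k, ∞), so {k} is the value of the closed term fᵏ(1) ∩
C(fᵏ⁺¹(1)), and {k+2} ∩ f({k}) ≠ 0 if and only if χ(k) (`probe_eq_zero_iff`).

Closed terms keep their values under any isomorphism, however non-effective (`map_probe`). In a
punctual copy these values are primitive recursive in k (`primrec_probe`), so comparing them with 0
would compute χ primitive recursively, a contradiction. -/

/-! ### Search-free codes and diagonalisation -/

namespace Nat.Partrec.Code

/-- `rfindFree c` holds if the code `c` makes no use of unbounded search. -/
def rfindFree (c : Code) : Bool :=
  Code.recOn c true true true true (fun _ _ a b => a && b) (fun _ _ a b => a && b)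
    (fun _ _ a b => a && b) (fun _ _ => false)

theorem computable_rfindFree : Computable rfindFree := by
  have hand : Computable₂ (fun (_ : Code) (x : Code × Code × Bool × Bool) =>
      x.2.2.1 && x.2.2.2) :=
    (Primrec.and.comp (Primrec.fst.comp (Primrec.snd.comp (Primrec.snd.comp Primrec.snd)))
      (Primrec.snd.comp (Primrec.snd.comp (Primrec.snd.comp Primrec.snd)))).to_comp
  exact computable_recOn (σ := Bool) Computable.id (Computable.const true) (Computable.const true)
    (Computable.const true) (Computable.const true) hand hand hand
    (rf := fun _ _ => false) (Computable.const false)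

/-- Only unbounded search can diverge. This makes the diagonal function below total. -/
theorem dom_of_rfindFree (c : Code) (hc : rfindFree c = true) (n : ℕ) : (eval c n).Dom := by
  induction c generalizing n with
  | zero | succ | left | right => trivial
  | pair c d ihc ihd =>
    have h : rfindFree c = true ∧ rfindFree d = true := by simpa [rfindFree] using hc
    exact Part.bind_dom.2 ⟨ihc h.1 n, ihd h.2 n⟩
  | comp c d ihc ihd =>
    have h : rfindFree c = true ∧ rfindFree d = true := by simpa [rfindFree] using hc
    exact Part.bind_dom.2 ⟨ihd h.2 n, ihc h.1 _⟩
  | prec c d ihc ihd =>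
    have h : rfindFree c = true ∧ rfindFree d = true := by simpa [rfindFree] using hc
    rw [← Nat.pair_unpair n]
    induction n.unpair.2 with
    | zero => rw [eval_prec_zero]; exact ihc h.1 _
    | succ k ih =>
      rw [eval_prec_succ]
      exact Part.bind_dom.2 ⟨ih, ihd h.2 _⟩
  | rfind' c => simp [rfindFree] at hc

theorem exists_rfindFree_of_primrec {f : ℕ → ℕ} (hf : Nat.Primrec f) :
    ∃ c : Code, rfindFree c = true ∧ eval c = f := by
  induction hf with
  | zero => exact ⟨zero, rfl, rfl⟩
  | succ => exact ⟨succ, rfl, rfl⟩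
  | left => exact ⟨left, rfl, rfl⟩
  | right => exact ⟨right, rfl, rfl⟩
  | pair _ _ ihf ihg =>
    obtain ⟨c, hc, hcf⟩ := ihf
    obtain ⟨d, hd, hdg⟩ := ihg
    refine ⟨pair c d, ?_, ?_⟩
    · simp [rfindFree] at hc hd ⊢
      exact ⟨hc, hd⟩
    · funext n
      simp [eval, hcf, hdg, Seq.seq]
  | comp _ _ ihf ihg =>
    obtain ⟨c, hc, hcf⟩ := ihf
    obtain ⟨d, hd, hdg⟩ := ihg
    refine ⟨comp c d, ?_, ?_⟩
    · simp [rfindFree] at hc hd ⊢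
      exact ⟨hc, hd⟩
    · funext n
      simp only [eval, hcf, hdg]
      exact Part.bind_some _ _
  | @prec f g _ _ ihf ihg =>
    obtain ⟨c, hc, hcf⟩ := ihf
    obtain ⟨d, hd, hdg⟩ := ihg
    refine ⟨prec c d, ?_, ?_⟩
    · simp [rfindFree] at hc hd ⊢
      exact ⟨hc, hd⟩
    · funext n
      rw [← Nat.pair_unpair n]
      induction n.unpair.2 with
      | zero => rw [eval_prec_zero, hcf]; simp
      | succ k ih => rw [eval_prec_succ, ih, hdg]; simp

end Nat.Partrec.Code

/-- There is a computable predicate on `ℕ` that is not primitive recursive. -/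
theorem exists_computable_bool_not_primrec : ∃ χ : ℕ → Bool, Computable χ ∧ ¬ Primrec χ := by
  -- The diagonal over search-free codes; on all other codes 0 is a default that keeps `g` total.
  let g : ℕ →. ℕ := fun n =>
    bif Nat.Partrec.Code.rfindFree (Denumerable.ofNat Nat.Partrec.Code n) then
      Nat.Partrec.Code.eval (Denumerable.ofNat Nat.Partrec.Code n) n else Part.some 0
  have hofNat : Computable (Denumerable.ofNat Nat.Partrec.Code) := Computable.ofNat _
  have hg : Partrec g := Partrec.cond (Nat.Partrec.Code.computable_rfindFree.comp hofNat)
    (Nat.Partrec.Code.eval_part.comp hofNat Computable.id) (Computable.const 0).partrec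
  have hdom (n : ℕ) : (g n).Dom := by
    cases h : Nat.Partrec.Code.rfindFree (Denumerable.ofNat Nat.Partrec.Code n) with
    | false => simp [g, h]
    | true => simpa [g, h] using Nat.Partrec.Code.dom_of_rfindFree _ h n
  let v : ℕ → ℕ := fun n => (g n).get (hdom n)
  have hv : Computable v := hg.of_eq_tot fun n => Part.get_mem (hdom n)
  -- Negating the diagonal makes χ differ from every primitive recursive predicate.
  refine ⟨fun n => decide (v n = 0),
    (Primrec.eq.decide.to_comp.comp hv (Computable.const 0)), fun hχ => ?_⟩
  have hp : Primrec fun n => bif decide (v n = 0) then 1 else 0 :=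
    Primrec.cond hχ (Primrec.const 1) (Primrec.const 0)
  obtain ⟨c, hc, hcv⟩ := Nat.Partrec.Code.exists_rfindFree_of_primrec (Primrec.nat_iff.1 hp)
  -- At the code of χ itself, the diagonal value would be 1 if it is 0, and 0 otherwise.
  have hval : v (Encodable.encode c) =
      bif decide (v (Encodable.encode c) = 0) then 1 else 0 := by
    have : g (Encodable.encode c) =
        Part.some (bif decide (v (Encodable.encode c) = 0) then 1 else 0) := by
      simp only [g, Denumerable.ofNat_encode, hc, cond_true, hcv]
      rfl
    exact Part.get_eq_of_mem (this ▸ Part.mem_some _) _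
  cases h : decide (v (Encodable.encode c) = 0) <;> simp_all

/-! ### Numbers with prescribed binary digits -/

namespace Nat

/-- The number whose binary digits are `h 0, …, h (N - 1)`. -/
def bitSum (h : ℕ → Bool) (N : ℕ) : ℕ :=
  Nat.rec 0 (fun i s => s + bif h i then 2 ^ i else 0) N

theorem bitSum_succ (h : ℕ → Bool) (N : ℕ) :
    bitSum h (N + 1) = bitSum h N + bif h N then 2 ^ N else 0 := rfl

theorem bitSum_lt (h : ℕ → Bool) (N : ℕ) : bitSum h N < 2 ^ N := by
  induction N with
  | zero => simp [bitSum]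
  | succ N ih =>
    rw [bitSum_succ, pow_succ]
    cases h N <;> simp <;> omega

/-- The partial sum is below `2 ^ N`, so adding `2 ^ N` sets digit `N` without a carry. -/
theorem testBit_bitSum (h : ℕ → Bool) (N i : ℕ) :
    (bitSum h N).testBit i = (decide (i < N) && h i) := by
  induction N with
  | zero => simp [bitSum]
  | succ N ih =>
    have hlt := bitSum_lt h N
    rw [bitSum_succ]
    rcases lt_trichotomy i N with hi | rfl | hi
    · cases hN : h N
      · simp [ih, hi, hi.trans (Nat.lt_succ_self N)]
      · simp only [cond_true]
        rw [add_comm, Nat.testBit_two_pow_add_gt hi, ih]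
        simp [hi, hi.trans (Nat.lt_succ_self N)]
    · cases hN : h i
      · simp [ih]
      · simp only [cond_true]
        rw [add_comm, Nat.testBit_two_pow_add_eq, Nat.testBit_lt_two_pow hlt]
        simp
    · have hle : bitSum h (N + 1) < 2 ^ i :=
        (bitSum_lt h (N + 1)).trans_le (Nat.pow_le_pow_right (by norm_num) hi)
      rw [← bitSum_succ, Nat.testBit_lt_two_pow hle]
      simp; omega

end Nat

theorem Primrec.nat_two_pow : Primrec fun n : ℕ => 2 ^ n :=
  (Primrec.nat_rec₁ (f := fun _ s => s * 2) 1
    (Primrec.nat_mul.comp Primrec.snd (Primrec.const 2))).of_eq fun n => by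
      induction n with
      | zero => rfl
      | succ n ih => rw [pow_succ, ← ih]

theorem Primrec.nat_testBit : Primrec₂ Nat.testBit :=
  (Primrec.eq.decide.comp (Primrec.nat_mod.comp
    (Primrec.nat_div.comp Primrec.fst (Primrec.nat_two_pow.comp Primrec.snd)) (Primrec.const 2))
    (Primrec.const 1)).of_eq fun _ => Nat.testBit_eq_decide_div_mod_eq.symm

theorem Computable.nat_bitSum {α : Type*} [Primcodable α] {h : α → ℕ → Bool} {N : α → ℕ}
    (hh : Computable₂ h) (hN : Computable N) : Computable fun a => Nat.bitSum (h a) (N a) := by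
  refine Computable.nat_rec hN (Computable.const 0)
    (h := fun a (x : ℕ × ℕ) => x.2 + bif h a x.1 then 2 ^ x.1 else 0) ?_
  exact Primrec.nat_add.to_comp.comp (Computable.snd.comp Computable.snd)
    (Computable.cond (hh.comp Computable.fst (Computable.fst.comp Computable.snd))
      (Primrec.nat_two_pow.to_comp.comp (Computable.fst.comp Computable.snd))
      (Computable.const 0))

/-! ### Finite and cofinite sets coded by natural numbers -/

namespace FiniteCofinite

/-- The eventual value of the characteristic function of the set coded by `c`. -/
def tail (c : ℕ) : Bool := c.testBit 0

/-- The characteristic function of the finite or cofinite set coded by `c`. -/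
def mem (c i : ℕ) : Bool := c.testBit (i + 1) ^^ tail c

/-- The code of the set whose characteristic function is `g` below `N` and `b` from `N` on. -/
def ofFun (b : Bool) (g : ℕ → Bool) (N : ℕ) : ℕ :=
  Nat.bit b (Nat.bitSum (fun i => g i ^^ b) N)

/-- A code `c` has no binary digit beyond position `c`, so the code itself bounds where its set
becomes constant. This supplies the bounds used in the operations below. -/
theorem mem_eq_tail {c i : ℕ} (h : c ≤ i) : mem c i = tail c := by
  have : c < 2 ^ (i + 1) := (Nat.lt_succ_of_le h).trans Nat.lt_two_pow_self
  simp [mem, Nat.testBit_lt_two_pow this]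

theorem mem_ofFun {b : Bool} {g : ℕ → Bool} {N : ℕ} (h : ∀ i, N ≤ i → g i = b) (i : ℕ) :
    mem (ofFun b g N) i = g i := by
  rw [mem, tail, ofFun, Nat.testBit_bit_succ, Nat.testBit_bit_zero, Nat.testBit_bitSum]
  by_cases hi : i < N
  · simp [hi]
  · simp [hi, h i (not_lt.1 hi)]

/-- The eventual value recovers digit 0, and xor with it recovers the other digits. Hence distinct
numbers code distinct sets, and all of ℕ can serve as the domain. -/
theorem mem_injective : Function.Injective mem := by
  intro c d h
  have ht : tail c = tail d := by
    rw [← mem_eq_tail (le_max_left c d), ← mem_eq_tail (le_max_right c d), h]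
  refine Nat.eq_of_testBit_eq fun i => ?_
  cases i with
  | zero => exact ht
  | succ i =>
    have := congrFun h i
    simpa [mem, ht] using this

/-- Union of coded sets. -/
def union (c d : ℕ) : ℕ := ofFun (tail c || tail d) (fun i => mem c i || mem d i) (max c d)

/-- Intersection of coded sets. -/
def inter (c d : ℕ) : ℕ := ofFun (tail c && tail d) (fun i => mem c i && mem d i) (max c d)

/-- Complement of a coded set. -/
def compl (c : ℕ) : ℕ := ofFun (!tail c) (fun i => !mem c i) c

/-- The set of all `n` with `n - 1 ∈ X`, or `n - 2 ∈ X` and `χ (n - 2)`. -/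
def shift (χ X : ℕ → Bool) (n : ℕ) : Bool :=
  (decide (1 ≤ n) && X (n - 1)) || (decide (2 ≤ n) && (X (n - 2) && χ (n - 2)))

/-- The operation `shift χ` on coded sets. -/
def modality (χ : ℕ → Bool) (c : ℕ) : ℕ := ofFun (tail c) (shift χ (mem c)) (c + 2)

theorem mem_union (c d : ℕ) : mem (union c d) = mem c ⊔ mem d := by
  funext i
  exact mem_ofFun (fun i hi => by
    rw [mem_eq_tail ((le_max_left c d).trans hi), mem_eq_tail ((le_max_right c d).trans hi)]) i

theorem mem_inter (c d : ℕ) : mem (inter c d) = mem c ⊓ mem d := by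
  funext i
  exact mem_ofFun (fun i hi => by
    rw [mem_eq_tail ((le_max_left c d).trans hi), mem_eq_tail ((le_max_right c d).trans hi)]) i

theorem mem_compl (c : ℕ) : mem (compl c) = (mem c)ᶜ := by
  funext i
  exact mem_ofFun (fun i hi => by rw [mem_eq_tail hi]) i

theorem mem_zero : mem 0 = ⊥ := by
  funext i
  simp [mem, tail]

theorem mem_one : mem 1 = ⊤ := by
  funext i
  simp [mem, tail, Nat.testBit_succ]

theorem mem_modality (χ : ℕ → Bool) (c : ℕ) : mem (modality χ c) = shift χ (mem c) := by
  funext i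
  refine mem_ofFun (fun i hi => ?_) i
  -- From `c + 2` on, both places looked up lie at or beyond `c`. There the value is t ∨ (t ∧ χ) =
  -- t: the unconditional shift by one absorbs χ, so finite and cofinite sets are preserved.
  rw [shift, mem_eq_tail (show c ≤ i - 1 by omega), mem_eq_tail (show c ≤ i - 2 by omega)]
  simp only [show 1 ≤ i by omega, show 2 ≤ i by omega, decide_true, Bool.true_and]
  cases tail c <;> rfl

theorem shift_sup (χ X Y : ℕ → Bool) : shift χ (X ⊔ Y) = shift χ X ⊔ shift χ Y := by
  funext i
  simp only [shift, Pi.sup_apply, Bool.sup_eq_bor]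
  cases decide (1 ≤ i) <;> cases decide (2 ≤ i) <;> cases X (i - 1) <;> cases X (i - 2) <;>
    cases Y (i - 1) <;> cases Y (i - 2) <;> simp

theorem shift_bot (χ : ℕ → Bool) : shift χ ⊥ = ⊥ := by
  funext i
  simp [shift]

theorem primrec_tail : Primrec tail := Primrec.nat_testBit.comp Primrec.id (Primrec.const 0)

theorem primrec_mem : Primrec₂ mem :=
  (Primrec.dom_bool₂ xor).comp (Primrec.nat_testBit.comp Primrec.fst (Primrec.succ.comp Primrec.snd))
    (primrec_tail.comp Primrec.fst)

theorem computable_ofFun {α : Type*} [Primcodable α] {b : α → Bool} {g : α → ℕ → Bool} {N : α → ℕ}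
    (hb : Computable b) (hg : Computable₂ g) (hN : Computable N) :
    Computable fun a => ofFun (b a) (g a) (N a) := by
  have h := Computable.nat_bitSum (h := fun a i => g a i ^^ b a)
    ((Primrec.dom_bool₂ xor).to_comp.comp hg (hb.comp Computable.fst)) hN
  exact Computable.cond hb (Primrec.nat_double_succ.to_comp.comp h)
    (Primrec.nat_double.to_comp.comp h)

theorem computable_union : Computable₂ union := by
  refine computable_ofFun ?_ ?_ Primrec.nat_max.to_comp
  · exact (Primrec.or.comp (primrec_tail.comp Primrec.fst) (primrec_tail.comp Primrec.snd)).to_comp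
  · exact (Primrec.or.comp
      (primrec_mem.comp (Primrec.fst.comp Primrec.fst) Primrec.snd)
      (primrec_mem.comp (Primrec.snd.comp Primrec.fst) Primrec.snd)).to_comp

theorem computable_inter : Computable₂ inter := by
  refine computable_ofFun ?_ ?_ Primrec.nat_max.to_comp
  · exact (Primrec.and.comp (primrec_tail.comp Primrec.fst) (primrec_tail.comp Primrec.snd)).to_comp
  · exact (Primrec.and.comp
      (primrec_mem.comp (Primrec.fst.comp Primrec.fst) Primrec.snd)
      (primrec_mem.comp (Primrec.snd.comp Primrec.fst) Primrec.snd)).to_comp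

theorem computable_compl : Computable compl :=
  computable_ofFun (Primrec.not.comp primrec_tail).to_comp (Primrec.not.comp primrec_mem).to_comp
    Computable.id

theorem computable_modality {χ : ℕ → Bool} (hχ : Computable χ) : Computable (modality χ) := by
  refine computable_ofFun primrec_tail.to_comp ?_
    (Primrec.nat_add.comp Primrec.id (Primrec.const 2)).to_comp
  have hle (k : ℕ) : Computable fun x : ℕ × ℕ => decide (k ≤ x.2) :=
    (Primrec.nat_le.decide.comp (Primrec.const k) Primrec.snd).to_comp
  have hsub (k : ℕ) : Primrec fun x : ℕ × ℕ => x.2 - k :=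
    Primrec.nat_sub.comp Primrec.snd (Primrec.const k)
  have hmem (k : ℕ) : Computable fun x : ℕ × ℕ => mem x.1 (x.2 - k) :=
    (primrec_mem.comp Primrec.fst (hsub k)).to_comp
  have hand := Primrec.and.to_comp
  exact Primrec.or.to_comp.comp (hand.comp (hle 1) (hmem 1))
    (hand.comp (hle 2) (hand.comp (hmem 2) (hχ.comp (hsub 2).to_comp)))

end FiniteCofinite

/-! ### Closed terms in the signature of modal algebras -/

namespace ModalAlgebra

section Terms

variable (M : Type) [S : modalLanguage.Structure M]

/-- The value of the closed term `f (f (⋯ (f 1)))`. -/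
def level (k : ℕ) : M :=
  (fun a => S.funMap ModalFunctions.modality ![a])^[k] (S.funMap ModalFunctions.one ![])

/-- The value of the closed term `fᵏ(1) ∩ C (fᵏ⁺¹(1))`. -/
def atom (k : ℕ) : M :=
  S.funMap ModalFunctions.inter
    ![level M k, S.funMap ModalFunctions.compl ![level M (k + 1)]]

/-- The value of the closed term `aₖ₊₂ ∩ f(aₖ)`, where `aₖ` is the `k`-th atom term. -/
def probe (k : ℕ) : M :=
  S.funMap ModalFunctions.inter
    ![atom M (k + 2), S.funMap ModalFunctions.modality ![atom M k]]

end Terms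

theorem level_succ (M : Type) [S : modalLanguage.Structure M] (k : ℕ) :
    level M (k + 1) = S.funMap ModalFunctions.modality ![level M k] := by
  simp only [level, Function.iterate_succ_apply']

section Transfer

variable {M N : Type} [S : modalLanguage.Structure M] [T : modalLanguage.Structure N]

theorem map_funMap₀ (e : modalLanguage.Equiv M N) (f : modalLanguage.Functions 0) :
    e (S.funMap f ![]) = T.funMap f ![] := by
  rw [e.map_fun]
  congr 1
  exact Subsingleton.elim _ _

theorem map_funMap₁ (e : modalLanguage.Equiv M N) (f : modalLanguage.Functions 1) (a : M) :
    e (S.funMap f ![a]) = T.funMap f ![e a] := by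
  rw [e.map_fun]
  congr 1
  funext i
  fin_cases i
  rfl

theorem map_funMap₂ (e : modalLanguage.Equiv M N) (f : modalLanguage.Functions 2) (a b : M) :
    e (S.funMap f ![a, b]) = T.funMap f ![e a, e b] := by
  rw [e.map_fun]
  congr 1
  funext i
  fin_cases i <;> rfl

/-- An isomorphism fixes the values of closed terms, so no effectivity of `e` is needed. -/
theorem map_level (e : modalLanguage.Equiv M N) (k : ℕ) : e (level M k) = level N k := by
  induction k with
  | zero => exact map_funMap₀ e ModalFunctions.one
  | succ k ih =>
    rw [level_succ, level_succ, ← ih]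
    exact map_funMap₁ e ModalFunctions.modality _

theorem map_atom (e : modalLanguage.Equiv M N) (k : ℕ) : e (atom M k) = atom N k := by
  rw [atom, atom, ← map_level e, ← map_level e]
  exact (map_funMap₂ e ModalFunctions.inter _ _).trans
    (congrArg (fun b => T.funMap ModalFunctions.inter ![e (level M k), b])
      (map_funMap₁ e ModalFunctions.compl _))

theorem map_probe (e : modalLanguage.Equiv M N) (k : ℕ) : e (probe M k) = probe N k := by
  rw [probe, probe, ← map_atom e, ← map_atom e]
  exact (map_funMap₂ e ModalFunctions.inter _ _).trans
    (congrArg (fun b => T.funMap ModalFunctions.inter ![e (atom M (k + 2)), b])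
      (map_funMap₁ e ModalFunctions.modality _))

end Transfer

theorem primrec_vec₁ {α : Type*} [Primcodable α] {u : α → ℕ} (hu : Primrec u) :
    Primrec fun a => ![u a] := by
  have h : Primrec₂ fun i a => ![u a] i := Primrec.fin_curry₁.2 fun i => ?_
  · exact Primrec.fin_curry.2 h.swap
  fin_cases i
  exact hu

theorem primrec_vec₂ {α : Type*} [Primcodable α] {u v : α → ℕ} (hu : Primrec u) (hv : Primrec v) :
    Primrec fun a => ![u a, v a] := by
  have h : Primrec₂ fun i a => ![u a, v a] i := Primrec.fin_curry₁.2 fun i => ?_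
  · exact Primrec.fin_curry.2 h.swap
  fin_cases i
  exacts [hu, hv]

/-- The terms grow with `k`, but their values come from iterating one primitive recursive operation
on a constant. -/
theorem primrec_probe [S : modalLanguage.Structure ℕ] (hS : IsPunctualStructure modalLanguage) :
    Primrec (probe ℕ) := by
  have hmod : Primrec fun a : ℕ => S.funMap ModalFunctions.modality ![a] :=
    (hS.primrec_funMap 1 ModalFunctions.modality).comp (primrec_vec₁ Primrec.id)
  have hlevel : Primrec (level ℕ) :=
    Primrec.nat_iterate Primrec.id (Primrec.const _) (hmod.comp Primrec.snd)
  have hatom : Primrec (atom ℕ) :=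
    (hS.primrec_funMap 2 ModalFunctions.inter).comp (primrec_vec₂ hlevel
      ((hS.primrec_funMap 1 ModalFunctions.compl).comp (primrec_vec₁ (hlevel.comp Primrec.succ))))
  exact (hS.primrec_funMap 2 ModalFunctions.inter).comp (primrec_vec₂
    (hatom.comp (Primrec.succ.comp Primrec.succ)) (hmod.comp hatom))

/-- A structure that embeds into the Boolean algebra of functions `ℕ → Bool`, with `f` acting as
a modality there, is a modal algebra. -/
theorem isModalAlgebra_of_injective {M : Type} [S : modalLanguage.Structure M] (φ : M → ℕ → Bool)
    (hφ : Function.Injective φ) (m : (ℕ → Bool) → ℕ → Bool) (hm : IsModality m)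
    (union : ∀ a b, φ (S.funMap ModalFunctions.union ![a, b]) = φ a ⊔ φ b)
    (inter : ∀ a b, φ (S.funMap ModalFunctions.inter ![a, b]) = φ a ⊓ φ b)
    (compl : ∀ a, φ (S.funMap ModalFunctions.compl ![a]) = (φ a)ᶜ)
    (zero : φ (S.funMap ModalFunctions.zero ![]) = ⊥)
    (one : φ (S.funMap ModalFunctions.one ![]) = ⊤)
    (modality : ∀ a, φ (S.funMap ModalFunctions.modality ![a]) = m (φ a)) :
    IsModalAlgebra M S := by
  let _ : Max M := ⟨fun a b => S.funMap ModalFunctions.union ![a, b]⟩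
  let _ : Min M := ⟨fun a b => S.funMap ModalFunctions.inter ![a, b]⟩
  let _ : Compl M := ⟨fun a => S.funMap ModalFunctions.compl ![a]⟩
  let _ : Bot M := ⟨S.funMap ModalFunctions.zero ![]⟩
  let _ : Top M := ⟨S.funMap ModalFunctions.one ![]⟩
  let _ : LE M := ⟨fun a b => φ a ≤ φ b⟩
  let _ : LT M := ⟨fun a b => φ a < φ b⟩
  -- Difference and implication are not in the signature; they are derived so that the Boolean
  -- structure can be pulled back along `φ`.
  let _ : SDiff M := ⟨fun a b => a ⊓ bᶜ⟩
  let _ : HImp M := ⟨fun a b => b ⊔ aᶜ⟩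
  have sdiff (a b : M) : φ (a \ b) = φ a \ φ b := by
    rw [sdiff_eq, ← compl]
    exact inter a _
  have himp (a b : M) : φ (a ⇨ b) = φ a ⇨ φ b := by
    rw [himp_eq, ← compl]
    exact union b _
  let _ : BooleanAlgebra M :=
    hφ.booleanAlgebra φ Iff.rfl Iff.rfl union inter one zero compl sdiff himp
  refine ⟨inferInstance,
    fun _ _ => rfl, fun _ _ => rfl, fun _ => rfl, rfl, rfl, ⟨?_, ?_⟩⟩
  · intro a b
    refine hφ ?_
    rw [modality]
    refine (congrArg m (union a b)).trans ?_
    rw [hm.map_sup, ← modality, ← modality]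
    exact (union _ _).symm
  · refine hφ ?_
    rw [modality]
    exact (congrArg m zero).trans (hm.map_bot.trans zero.symm)

end ModalAlgebra

/-! ### The computable modal algebra encoding χ -/

namespace FiniteCofinite

open ModalAlgebra

/-- The modal algebra of finite and cofinite sets of natural numbers with `shift χ` as modality. -/
@[reducible] def modalStructure (χ : ℕ → Bool) : modalLanguage.Structure (Set.univ : Set ℕ) where
  funMap f x := match f with
    | ModalFunctions.union => ⟨union (x 0) (x 1), trivial⟩
    | ModalFunctions.inter => ⟨inter (x 0) (x 1), trivial⟩
    | ModalFunctions.compl => ⟨compl (x 0), trivial⟩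
    | ModalFunctions.zero => ⟨0, trivial⟩
    | ModalFunctions.one => ⟨1, trivial⟩
    | ModalFunctions.modality => ⟨modality χ (x 0), trivial⟩
  RelMap r := nomatch r

theorem isComputableStructure {χ : ℕ → Bool} (hχ : Computable χ) :
    @IsComputableStructure modalLanguage _ Set.univ (modalStructure χ) := by
  let _ := modalStructure χ
  have happ (n : ℕ) (i : Fin n) : Computable fun x : Fin n → ℕ => x i :=
    Computable.fin_app.comp Computable.id (Computable.const i)
  refine ⟨Set.infinite_univ, ⟨fun _ => isTrue trivial, Computable.const true⟩, ?_, ?_⟩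
  · intro n f
    cases f with
    | union => exact ⟨fun x => union (x 0) (x 1),
        computable_union.comp (happ 2 0) (happ 2 1), fun _ => rfl⟩
    | inter => exact ⟨fun x => inter (x 0) (x 1),
        computable_inter.comp (happ 2 0) (happ 2 1), fun _ => rfl⟩
    | compl => exact ⟨fun x => compl (x 0), computable_compl.comp (happ 1 0), fun _ => rfl⟩
    | zero => exact ⟨fun _ => 0, Computable.const 0, fun _ => rfl⟩
    | one => exact ⟨fun _ => 1, Computable.const 1, fun _ => rfl⟩
    | modality => exact ⟨fun x => modality χ (x 0),
        (computable_modality hχ).comp (happ 1 0), fun _ => rfl⟩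
  · intro n r
    exact nomatch r

theorem isModalAlgebra (χ : ℕ → Bool) : IsModalAlgebra (Set.univ : Set ℕ) (modalStructure χ) := by
  let _ := modalStructure χ
  exact isModalAlgebra_of_injective (fun a : (Set.univ : Set ℕ) => mem a)
    (mem_injective.comp Subtype.val_injective) (shift χ) ⟨shift_sup χ, shift_bot χ⟩
    (fun _ _ => mem_union _ _) (fun _ _ => mem_inter _ _) (fun _ => mem_compl _) mem_zero mem_one
    (fun _ => mem_modality χ _)

section Probe

variable (χ : ℕ → Bool)

/-- The shift by one sends [k, ∞) to [k+1, ∞); the part depending on χ only adds points from k+2 on,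
already present. -/
theorem mem_level (k i : ℕ) :
    mem (@level (Set.univ : Set ℕ) (modalStructure χ) k) i = decide (k ≤ i) := by
  let _ := modalStructure χ
  induction k generalizing i with
  | zero => exact (congrFun mem_one i).trans (by simp)
  | succ k ih =>
    rw [level_succ]
    refine (congrFun (mem_modality χ _) i).trans ?_
    simp only [shift, Matrix.cons_val_zero, ih]
    rw [Bool.eq_iff_iff]
    simp only [Bool.or_eq_true, Bool.and_eq_true, decide_eq_true_eq]
    omega

theorem mem_atom (k i : ℕ) :
    mem (@atom (Set.univ : Set ℕ) (modalStructure χ) k) i = decide (i = k) := by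
  let _ := modalStructure χ
  refine (congrFun (mem_inter _ _) i).trans ?_
  have h := congrFun (mem_compl (level (Set.univ : Set ℕ) (k + 1))) i
  change (mem _ i && mem (compl (level (Set.univ : Set ℕ) (k + 1))) i) = _
  rw [h]
  simp only [Pi.compl_apply, Matrix.cons_val_zero, mem_level]
  rw [Bool.eq_iff_iff]
  simp
  omega

/-- Intersecting with {k+2} discards the point k+1 of f({k}) and leaves the one point controlled by
χ(k). -/
theorem mem_probe (k i : ℕ) :
    mem (@probe (Set.univ : Set ℕ) (modalStructure χ) k) i = (decide (i = k + 2) && χ k) := by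
  let _ := modalStructure χ
  refine (congrFun (mem_inter _ _) i).trans ?_
  have h := congrFun (mem_modality χ (atom (Set.univ : Set ℕ) k)) i
  change (mem _ i && mem (modality χ (atom (Set.univ : Set ℕ) k)) i) = _
  rw [h]
  simp only [shift, Matrix.cons_val_zero, mem_atom]
  by_cases hi : i = k + 2
  · subst hi
    simp
  · simp [hi]

theorem probe_eq_zero_iff (k : ℕ) :
    @probe (Set.univ : Set ℕ) (modalStructure χ) k =
      (modalStructure χ).funMap ModalFunctions.zero ![] ↔ χ k = false := by
  let _ := modalStructure χ
  constructor
  · intro h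
    have h' := mem_probe χ k (k + 2)
    rw [h] at h'
    have h0 : mem 0 (k + 2) = false := congrFun mem_zero _
    simpa using h'.symm.trans h0
  · intro h
    refine Subtype.ext (mem_injective (funext fun i => ?_))
    rw [mem_probe, h, Bool.and_false]
    exact (congrFun mem_zero i).symm

end Probe

end FiniteCofinite

theorem theorem3 : ¬ PunctuallyRobust modalLanguage IsModalAlgebra := by
  intro hrobust
  obtain ⟨χ, hχ, hχ'⟩ := exists_computable_bool_not_primrec
  let _ := FiniteCofinite.modalStructure χ
  obtain ⟨T, hT, ⟨e⟩⟩ := hrobust Set.univ (FiniteCofinite.modalStructure χ)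
    (FiniteCofinite.isComputableStructure hχ) (FiniteCofinite.isModalAlgebra χ)
  -- In the punctual copy, χ(k) is decided by testing whether the `k`-th probe differs from 0.
  refine hχ' ((Primrec.not.comp (Primrec.eq.decide.comp (ModalAlgebra.primrec_probe hT)
    (Primrec.const (T.funMap ModalFunctions.zero ![])))).of_eq fun k => ?_)
  have h := FiniteCofinite.probe_eq_zero_iff χ k
  rw [← e.injective.eq_iff, ModalAlgebra.map_probe,
    ModalAlgebra.map_funMap₀ e ModalFunctions.zero] at h
  cases hk : χ k <;> simp_all
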